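/- Let $d\in\mathbb N$ and let $\mathcal H=L^2(\mathbb R^d)\otimes L^2(\mathbb R^d)$ be the Hilbert space tensor product of complex $L^2$ spaces with Lebesgue measure (inner products are linear in the first variable). For $x,\omega\in\mathbb R^d$ and $g\in L^2(\mathbb R^d)$ put $(\pi(x,\omega)g)(t)=e^{2\pi i\,\omega\cdot t}g(t-x)$. For $a,b\in L^2(\mathbb R^d)$ and $f\in\mathcal H$, define the short-time Fourier transform of $f$ with window $a\otimes b$ by $$V_{a\otimes b}f(x,\omega)=\langle f,\ \pi(x_1,\omega_1)a\otimes\pi(x_2,\omega_2)b\rangle_{\mathcal H},\qquad x=(x_1,x_2),\ \omega=(\omega_1,\omega_2)\in\mathbb R^{2d}.$$ Let $\varphi_1,\varphi_2,\phi_1,\phi_2\in L^2(\mathbb R^d)\setminus\{0\}$, let $1\le p<\infty$ and let $m\in L^p(\mathbb R^{4d})$ be complex-valued. Then the integrals $$\int_{\mathbb R^{2d}}\int_{\mathbb R^{2d}} m(x,\omega)\,V_{\varphi_1\otimes\varphi_2}f(x,\omega)\,\overline{V_{\phi_1\otimes\phi_2}g(x,\omega)}\,dx\,d\omega ,\qquad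 f,g\in\mathcal H,$$ converge absolutely, and there is a bounded linear operator $M$ on $\mathcal H$ (the bilinear localization operator with symbol $m$ and windows $\varphi_1\otimes\varphi_2$, $\phi_1\otimes\phi_2$) such that $\langle Mf,g\rangle$ equals this integral for all $f,g\in\mathcal H$. It is the only bounded operator on $\mathcal H$ for which this identity holds for all simple tensors $f=f_1\otimes f_2$ and $g=g_1\otimes g_2$. The operator $M$ belongs to the Schatten class $\mathcal S_p(\mathcal H)$, i.e. $M$ is compact and its singular values (the eigenvalues of $(M^*M)^{1/2}$, repeated according to multiplicity) form an $\ell^p$ sequence. -/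

import Mathlib

open MeasureTheory
open scoped TensorProduct ENNReal

noncomputable section

namespace BilinearSTFT

/-! ### Schatten classes -/

/-- The multiplicity of `s` as a singular value of an operator `T` on a Hilbert space: the
dimension of the eigenspace at `s` of `|T|`, the non-negative square root of `T* T`.
If `T` is compact and `s > 0`, this eigenspace is finite dimensional. -/
def singularMultiplicity {K : Type*} [NormedAddCommGroup K] [InnerProductSpace ℂ K]
    [CompleteSpace K] (T : K →L[ℂ] K) (s : ℝ) : ℕ :=
  Module.finrank ℂ (Module.End.eigenspace ((CFC.abs T : K →L[ℂ] K) : K →ₗ[ℂ] K) (s : ℂ))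

/-- The Schatten class `S_p`, `1 ≤ p < ∞`: the compact operators whose singular values, repeated
according to multiplicity, form an `ℓ^p` sequence. (The singular value `0` contributes nothing.) -/
def IsSchatten {K : Type*} [NormedAddCommGroup K] [InnerProductSpace ℂ K]
    [CompleteSpace K] (p : ℝ) (T : K →L[ℂ] K) : Prop :=
  IsCompactOperator T ∧
    Summable fun s : Set.Ioi (0 : ℝ) => (singularMultiplicity T s : ℝ) * (s : ℝ) ^ p

/-! ### The Hilbert space `L²(ℝ^d) ⊗ L²(ℝ^d)` -/

/-- The Hilbert space `L²(ℝ^d)`. -/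
abbrev L2 (d : ℕ) : Type := Lp ℂ 2 (volume : Measure (EuclideanSpace ℝ (Fin d)))

/-- The Hilbert space tensor product `L²(ℝ^d) ⊗ L²(ℝ^d)`: the completion of the algebraic tensor
product for the inner product with `⟨a ⊗ b, a' ⊗ b'⟩ = ⟨a, a'⟩ ⟨b, b'⟩`. -/
abbrev L2Tensor (d : ℕ) : Type := UniformSpace.Completion (L2 d ⊗[ℂ] L2 d)

/-- The simple tensor `a ⊗ b`, as an element of the Hilbert space tensor product. -/
def simpleTensor {d : ℕ} (a b : L2 d) : L2Tensor d :=
  ((a ⊗ₜ[ℂ] b : L2 d ⊗[ℂ] L2 d) : UniformSpace.Completion (L2 d ⊗[ℂ] L2 d))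

/-! ### Time-frequency shifts and the short-time Fourier transform -/

/-- The time-frequency plane `ℝ^d × ℝ^d`, with points `(x, ω)` and Lebesgue measure. -/
abbrev TFPlane (d : ℕ) : Type := EuclideanSpace ℝ (Fin d) × EuclideanSpace ℝ (Fin d)

theorem memLp_shift {d : ℕ} (z : TFPlane d) (g : L2 d) :
    MemLp (fun t : EuclideanSpace ℝ (Fin d) =>
      Real.fourierChar (inner ℝ z.2 t) • g (t - z.1)) 2 volume := by
  have h1 : MemLp (fun t : EuclideanSpace ℝ (Fin d) => g (t - z.1)) 2 volume :=
    (Lp.memLp g).comp_measurePreserving (measurePreserving_sub_right volume z.1)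
  have hc : Continuous fun t : EuclideanSpace ℝ (Fin d) =>
      Real.fourierChar (inner ℝ z.2 t) := by fun_prop
  refine h1.of_le ?_ (Filter.Eventually.of_forall fun t => ?_)
  · have hc' : Continuous fun t : EuclideanSpace ℝ (Fin d) =>
        ((Real.fourierChar (inner ℝ z.2 t) : Circle) : ℂ) := by fun_prop
    exact hc'.aestronglyMeasurable.smul h1.1
  · simp

/-- The time-frequency shift `π(x, ω) = M_ω T_x` on `L²(ℝ^d)`:
`(π(x, ω) g)(t) = exp(2πi ω·t) g(t - x)`. -/
def shift {d : ℕ} (z : TFPlane d) (g : L2 d) : L2 d :=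
  (memLp_shift z g).toLp _

/-- The STFT of `f ∈ L²(ℝ^d) ⊗ L²(ℝ^d)` with window `a ⊗ b`, as a function of
`((x₁, ω₁), (x₂, ω₂))`: the inner product, linear in `f`, of `f` with
`π(x₁, ω₁) a ⊗ π(x₂, ω₂) b`. -/
def stft {d : ℕ} (a b : L2 d) (f : L2Tensor d) (z : TFPlane d × TFPlane d) : ℂ :=
  inner ℂ (simpleTensor (shift z.1 a) (shift z.2 b)) f

/-- `m · V_{φ₁ ⊗ φ₂} f · conj (V_{ψ₁ ⊗ ψ₂} g)`. -/
def locIntegrand {d : ℕ} (m : TFPlane d × TFPlane d → ℂ) (φ₁ φ₂ ψ₁ ψ₂ : L2 d)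
    (f g : L2Tensor d) (z : TFPlane d × TFPlane d) : ℂ :=
  m z * stft φ₁ φ₂ f z * (starRingEnd ℂ) (stft ψ₁ ψ₂ g z)

end BilinearSTFT

end

/-! With `u z = π(z₁)φ₁ ⊗ π(z₂)φ₂` and `v z` built likewise from `ψ₁`, `ψ₂`, the operator is the
weak integral of `m z ⟨u z, ·⟩ v z`. Only three facts about `u` and `v` matter, collected in
`IsBesselFamily`: continuity, a uniform norm bound, and an `L²` bound on coefficients. The last
comes from Moyal's identity on each factor, extended to tensors.

The weight `w = |⟨u, f⟩ ⟨v, g⟩|` then has both supremum and integral at most `C D ‖f‖ ‖g‖`. Jensen's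
inequality bounds `∫ |m| w` by `‖m‖_p C D ‖f‖ ‖g‖`, with no interpolation of operators; Riesz
representation gives the operator.

For orthonormal `eᵢ`, `fᵢ` the weights also satisfy `∑ wᵢ(z) ≤ C D` pointwise, so the same Jensen
step yields `∑ |⟨fᵢ, T eᵢ⟩|^p ≤ (C D)^p ‖m‖_p^p`. Eigenvectors of `|T|` and their normalized images
under `T` turn this into the bound on singular values. Compactness is separate: approximate `m` in
`L^p` by continuous compactly supported symbols. Uniqueness is density of the span of simple
tensors. -/

namespace BilinearSTFT

open scoped NNReal Topology
open Filter InnerProductSpace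

set_option linter.unusedSectionVars false

/-! ### Singular values tested on orthonormal families -/

section Schatten

variable {K : Type*} [NormedAddCommGroup K] [InnerProductSpace ℂ K]

/-- Every subspace contains an orthonormal family with `finrank` many elements; the family is empty
when the subspace is infinite dimensional. -/
theorem exists_orthonormal_fin_finrank (E : Submodule ℂ K) :
    ∃ e : Fin (Module.finrank ℂ E) → E, Orthonormal ℂ e := by
  by_cases h : FiniteDimensional ℂ E
  · exact ⟨_, (stdOrthonormalBasis ℂ E).orthonormal⟩
  · have h0 : Module.finrank ℂ E = 0 := Module.finrank_of_not_finite h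
    have : IsEmpty (Fin (Module.finrank ℂ E)) := by rw [h0]; infer_instance
    exact ⟨isEmptyElim, ⟨fun i => isEmptyElim i, fun i => isEmptyElim i⟩⟩

variable [CompleteSpace K]

/-- This is `T* T = |T|²`. It makes `T` send orthogonal eigenvectors of `|T|` to orthogonal vectors,
so no polar decomposition is needed. -/
theorem inner_apply_apply_eq_inner_abs (T : K →L[ℂ] K) (x y : K) :
    inner ℂ (T x) (T y) = inner ℂ (CFC.abs T x) (CFC.abs T y) := by
  have hsa : IsSelfAdjoint (CFC.abs T) := (CFC.abs_nonneg T).isSelfAdjoint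
  have h : star T * T = CFC.abs T * CFC.abs T := (CFC.abs_mul_abs T).symm
  calc inner ℂ (T x) (T y) = inner ℂ x ((star T * T) y) := by
        rw [ContinuousLinearMap.star_eq_adjoint, mul_apply_eq_comp,
          ContinuousLinearMap.adjoint_inner_right]
    _ = inner ℂ (CFC.abs T x) (CFC.abs T y) := by
        rw [h, mul_apply_eq_comp]
        exact (hsa.isSymmetric x (CFC.abs T y)).symm

/-- If `∑ |⟨fᵢ, T eᵢ⟩|^p` is bounded uniformly over all pairs of finite orthonormal families, then
the singular values of `T` form an `ℓ^p` sequence. -/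
theorem summable_singularMultiplicity (T : K →L[ℂ] K) (p C : ℝ)
    (h : ∀ (ι : Type) [Fintype ι] (e f : ι → K), Orthonormal ℂ e → Orthonormal ℂ f →
      ∑ i, ‖inner ℂ (f i) (T (e i))‖ ^ p ≤ C) :
    Summable fun s : Set.Ioi (0 : ℝ) => (singularMultiplicity T s : ℝ) * (s : ℝ) ^ p := by
  refine summable_of_sum_le (c := C)
    (fun s => mul_nonneg (Nat.cast_nonneg _) (Real.rpow_nonneg (le_of_lt s.2) _)) fun S => ?_
  have hsym : ((CFC.abs T : K →L[ℂ] K) : K →ₗ[ℂ] K).IsSymmetric :=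
    (CFC.abs_nonneg T).isSelfAdjoint.isSymmetric
  -- Eigenspaces of the self-adjoint `|T|` at distinct values are orthogonal, so orthonormal
  -- families chosen in each one join into a single family.
  choose b hb using fun s : ℝ => exists_orthonormal_fin_finrank
    (Module.End.eigenspace ((CFC.abs T : K →L[ℂ] K) : K →ₗ[ℂ] K) (s : ℂ))
  have hinj : Function.Injective fun s : S => (((s : Set.Ioi (0 : ℝ)) : ℝ) : ℂ) := fun s t hst =>
    Subtype.ext (Subtype.ext (Complex.ofReal_injective hst))
  have hO := hsym.orthogonalFamily_eigenspaces.comp hinj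
  have he := hO.orthonormal_sigma_orthonormal (fun s : S => hb (s : Set.Ioi (0 : ℝ)))
  let N : S → ℕ := fun s => singularMultiplicity T (s : Set.Ioi (0 : ℝ))
  let e : (Σ s : S, Fin (N s)) → K := fun a => (b ((a.1 : Set.Ioi (0 : ℝ)) : ℝ) a.2 : K)
  have he' : Orthonormal ℂ e := he
  let σ : (Σ s : S, Fin (N s)) → ℝ := fun a => ((a.1 : Set.Ioi (0 : ℝ)) : ℝ)
  have hσ : ∀ a, 0 < σ a := fun a => (a.1 : Set.Ioi (0 : ℝ)).2
  have habs : ∀ a, CFC.abs T (e a) = (σ a : ℂ) • e a := fun a =>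
    Module.End.mem_eigenspace_iff.mp (b ((a.1 : Set.Ioi (0 : ℝ)) : ℝ) a.2).2
  have hTT : ∀ a c, inner ℂ (T (e a)) (T (e c)) = (σ a : ℂ) * σ c * inner ℂ (e a) (e c) := by
    intro a c
    rw [inner_apply_apply_eq_inner_abs, habs, habs, inner_smul_left, inner_smul_right,
      Complex.conj_ofReal]
    ring
  -- The left singular vectors: orthonormal, with `⟨f a, T (e a)⟩ = σ a`.
  let f : (Σ s : S, Fin (N s)) → K := fun a => ((σ a : ℂ)⁻¹) • T (e a)
  have hσ0 : ∀ a, (σ a : ℂ) ≠ 0 := fun a => Complex.ofReal_ne_zero.mpr (hσ a).ne'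
  have hf : Orthonormal ℂ f := by
    classical
    rw [orthonormal_iff_ite] at he' ⊢
    intro a c
    simp only [f, inner_smul_left, inner_smul_right, hTT, he', map_inv₀, Complex.conj_ofReal]
    split_ifs with hac
    · subst hac; field_simp [hσ0 a]
    · simp
  have hval : ∀ a, ‖inner ℂ (f a) (T (e a))‖ ^ p = σ a ^ p := by
    intro a
    have h1 : inner ℂ (e a) (e a) = 1 := by
      rw [inner_self_eq_norm_sq_to_K, he'.1 a]; simp
    have : inner ℂ (f a) (T (e a)) = (σ a : ℂ) := by
      simp only [f, inner_smul_left, hTT, h1, map_inv₀, Complex.conj_ofReal]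
      field_simp [hσ0 a]
    rw [this, Complex.norm_real, Real.norm_of_nonneg (hσ a).le]
  have := h _ e f he' hf
  simp only [hval] at this
  rw [Fintype.sum_sigma] at this
  simp only [σ, Finset.sum_const, Finset.card_univ, Fintype.card_fin, nsmul_eq_mul, N] at this
  rwa [Finset.sum_coe_sort S
    (fun s : Set.Ioi (0 : ℝ) => (singularMultiplicity T s : ℝ) * (s : ℝ) ^ p)] at this

end Schatten

/-! ### Weighted estimates for Bessel families -/

section Bessel

variable {X : Type*} [MeasurableSpace X] {μ : Measure X}

/-- Jensen's inequality for a density `w` of mass at most `D`. -/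
theorem rpow_lintegral_mul_le {p : ℝ} (hp : 1 ≤ p) {h w : X → ℝ≥0∞} (hh : AEMeasurable h μ)
    (hw : AEMeasurable w μ) {D : ℝ≥0∞} (hD : ∫⁻ z, w z ∂μ ≤ D) :
    (∫⁻ z, h z * w z ∂μ) ^ p ≤ (∫⁻ z, h z ^ p * w z ∂μ) * D ^ (p - 1) := by
  have hp0 : 0 < p := by linarith
  have hinv : p⁻¹ ≤ 1 := inv_le_one_of_one_le₀ hp
  -- Hölder for `h^p w` and `w` with weights `1/p` and `1 - 1/p`; this form includes `p = 1`.
  have key := ENNReal.lintegral_mul_norm_pow_le (μ := μ) ((hh.pow_const p).mul hw) hw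
    (p := p⁻¹) (q := 1 - p⁻¹) (by positivity) (by linarith) (by ring)
  have hint : ∀ z, (h z ^ p * w z) ^ p⁻¹ * w z ^ (1 - p⁻¹) = h z * w z := by
    intro z
    rw [ENNReal.mul_rpow_of_nonneg _ _ (by positivity), ← ENNReal.rpow_mul,
      mul_inv_cancel₀ hp0.ne', ENNReal.rpow_one, mul_assoc,
      ← ENNReal.rpow_add_of_nonneg _ _ (by positivity) (by linarith)]
    simp
  simp only [Pi.mul_apply, hint] at key
  calc (∫⁻ z, h z * w z ∂μ) ^ p
      ≤ ((∫⁻ z, h z ^ p * w z ∂μ) ^ p⁻¹ * (∫⁻ z, w z ∂μ) ^ (1 - p⁻¹)) ^ p := by gcongr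
    _ = (∫⁻ z, h z ^ p * w z ∂μ) * (∫⁻ z, w z ∂μ) ^ (p - 1) := by
        rw [ENNReal.mul_rpow_of_nonneg _ _ hp0.le, ← ENNReal.rpow_mul, ← ENNReal.rpow_mul,
          inv_mul_cancel₀ hp0.ne', ENNReal.rpow_one]
        congr 2
        field_simp
    _ ≤ _ := by gcongr

variable [TopologicalSpace X] {K : Type*} [NormedAddCommGroup K] [InnerProductSpace ℂ K]

/-- A continuous bounded family of vectors for which the analysis operator `f ↦ ⟨u z, f⟩` is bounded
into `L²`. -/
structure IsBesselFamily (μ : Measure X) (C : ℝ≥0) (u : X → K) : Prop where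
  continuous : Continuous u
  enorm_le : ∀ z, ‖u z‖ₑ ≤ C
  lintegral_le : ∀ f, ∫⁻ z, ‖inner ℂ (u z) f‖ₑ ^ 2 ∂μ ≤ (C * ‖f‖ₑ) ^ 2

variable [OpensMeasurableSpace X] {C D : ℝ≥0} {u v : X → K}

/-- The product of the moduli of the coefficients of `f` and `g`. -/
noncomputable def coeffProd (u v : X → K) (f g : K) (z : X) : ℝ≥0∞ :=
  ‖inner ℂ (u z) f‖ₑ * ‖inner ℂ (v z) g‖ₑ

theorem enorm_inner_le_mul (x y : K) : ‖inner ℂ x y‖ₑ ≤ ‖x‖ₑ * ‖y‖ₑ := by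
  simp only [enorm_eq_nnnorm, ← ENNReal.coe_mul, ENNReal.coe_le_coe]
  exact nnnorm_inner_le_nnnorm x y

namespace IsBesselFamily

theorem measurable_coeffProd (hu : Continuous u) (hv : Continuous v) (f g : K) :
    Measurable (coeffProd u v f g) := by
  unfold coeffProd
  have h1 : Continuous fun z => inner ℂ (u z) f := by fun_prop
  have h2 : Continuous fun z => inner ℂ (v z) g := by fun_prop
  exact h1.enorm.measurable.mul h2.enorm.measurable

theorem coeffProd_le (hu : IsBesselFamily μ C u) (hv : IsBesselFamily μ D v) (f g : K) (z : X) :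
    coeffProd u v f g z ≤ C * D * (‖f‖ₑ * ‖g‖ₑ) := by
  calc coeffProd u v f g z ≤ (‖u z‖ₑ * ‖f‖ₑ) * (‖v z‖ₑ * ‖g‖ₑ) := by
        unfold coeffProd; gcongr <;> exact enorm_inner_le_mul _ _
    _ ≤ (C * ‖f‖ₑ) * (D * ‖g‖ₑ) := by
        gcongr
        · exact hu.enorm_le z
        · exact hv.enorm_le z
    _ = _ := by ring

/-- Cauchy–Schwarz in `L²(μ)` and the two analysis bounds. -/
theorem lintegral_coeffProd_le (hu : IsBesselFamily μ C u) (hv : IsBesselFamily μ D v) (f g : K) :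
    ∫⁻ z, coeffProd u v f g z ∂μ ≤ C * D * (‖f‖ₑ * ‖g‖ₑ) := by
  have hu' := hu.continuous
  have hv' := hv.continuous
  have h1 : Continuous fun z => inner ℂ (u z) f := by fun_prop
  have h2 : Continuous fun z => inner ℂ (v z) g := by fun_prop
  have := ENNReal.lintegral_mul_le_Lp_mul_Lq μ Real.HolderConjugate.two_two
    h1.enorm.measurable.aemeasurable h2.enorm.measurable.aemeasurable
  refine this.trans ?_
  have e1 : (∫⁻ z, ‖inner ℂ (u z) f‖ₑ ^ (2 : ℝ) ∂μ) ^ (1 / (2 : ℝ)) ≤ C * ‖f‖ₑ := by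
    rw [one_div, ENNReal.rpow_inv_le_iff two_pos]
    simpa using hu.lintegral_le f
  have e2 : (∫⁻ z, ‖inner ℂ (v z) g‖ₑ ^ (2 : ℝ) ∂μ) ^ (1 / (2 : ℝ)) ≤ D * ‖g‖ₑ := by
    rw [one_div, ENNReal.rpow_inv_le_iff two_pos]
    simpa using hv.lintegral_le g
  calc _ ≤ (C * ‖f‖ₑ) * (D * ‖g‖ₑ) := mul_le_mul' e1 e2
    _ = _ := by ring

variable {p : ℝ} {m : X → ℂ}

/-- Jensen with the coefficient product as density: its mass contributes `A^(p-1)` and its supremum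
the remaining factor `A`. -/
theorem lintegral_enorm_mul_coeffProd_le (hu : IsBesselFamily μ C u) (hv : IsBesselFamily μ D v)
    (hp : 1 ≤ p) (hm : AEStronglyMeasurable m μ) (f g : K) :
    ∫⁻ z, ‖m z‖ₑ * coeffProd u v f g z ∂μ ≤
      eLpNorm m (ENNReal.ofReal p) μ * (C * D * (‖f‖ₑ * ‖g‖ₑ)) := by
  have hp0 : 0 < p := by linarith
  set A := (C : ℝ≥0∞) * D * (‖f‖ₑ * ‖g‖ₑ) with hA
  have hAtop : A ≠ ∞ := ENNReal.mul_ne_top (ENNReal.mul_ne_top ENNReal.coe_ne_top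
    ENNReal.coe_ne_top) (ENNReal.mul_ne_top enorm_ne_top enorm_ne_top)
  rw [eLpNorm_eq_lintegral_rpow_enorm_toReal (by simpa using hp0) ENNReal.ofReal_ne_top,
    ENNReal.toReal_ofReal hp0.le, ← ENNReal.rpow_le_rpow_iff hp0,
    ENNReal.mul_rpow_of_nonneg _ _ hp0.le, ← ENNReal.rpow_mul, one_div, inv_mul_cancel₀ hp0.ne',
    ENNReal.rpow_one]
  refine (rpow_lintegral_mul_le hp hm.enorm
    (measurable_coeffProd hu.continuous hv.continuous f g).aemeasurable
    (hu.lintegral_coeffProd_le hv f g)).trans ?_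
  calc _ ≤ (∫⁻ z, ‖m z‖ₑ ^ p * A ∂μ) * A ^ (p - 1) := by
        gcongr with z
        exact hu.coeffProd_le hv f g z
    _ = (∫⁻ z, ‖m z‖ₑ ^ p ∂μ) * A ^ p := by
        rw [lintegral_mul_const' _ _ hAtop, mul_assoc]
        congr 1
        conv_lhs => rw [← ENNReal.rpow_one A]
        rw [ENNReal.rpow_one, mul_comm]
        nth_rewrite 2 [← ENNReal.rpow_one A]
        rw [← ENNReal.rpow_add_of_nonneg _ _ (by linarith) zero_le_one]
        simp

/-- At fixed `z`, Cauchy–Schwarz over `i`, then Bessel's inequality for `u z` against `e` and `v z`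
against `f`. The bound does not depend on the number of vectors. -/
theorem sum_coeffProd_le (hu : IsBesselFamily μ C u) (hv : IsBesselFamily μ D v)
    {ι : Type*} [Fintype ι] {e f : ι → K} (he : Orthonormal ℂ e) (hf : Orthonormal ℂ f) (z : X) :
    ∑ i, coeffProd u v (e i) (f i) z ≤ C * D := by
  have bessel : ∀ {x : K} {A : ℝ≥0} {b : ι → K}, Orthonormal ℂ b → ‖x‖ₑ ≤ A →
      (∑ i, ‖inner ℂ x (b i)‖ₑ ^ (2 : ℝ)) ^ (1 / (2 : ℝ)) ≤ A := by
    intro x A b hb hx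
    rw [one_div, ENNReal.rpow_inv_le_iff two_pos]
    refine le_trans ?_ (ENNReal.rpow_le_rpow hx two_pos.le)
    have h1 := hb.sum_inner_products_le x (s := Finset.univ)
    simp only [enorm_eq_nnnorm, ENNReal.rpow_ofNat, ← ENNReal.coe_pow, ← ENNReal.ofNNReal_finsetSum,
      ENNReal.coe_le_coe]
    rw [← NNReal.coe_le_coe]
    push_cast
    simpa only [norm_inner_symm] using h1
  exact (ENNReal.inner_le_Lp_mul_Lq _ _ _ Real.HolderConjugate.two_two).trans
    (mul_le_mul' (bessel he (hu.enorm_le z)) (bessel hf (hv.enorm_le z)))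

/-- The Schatten estimate: Jensen for each `i`, then the sum moves inside the integral, where the
pointwise bound applies. -/
theorem sum_rpow_lintegral_le (hu : IsBesselFamily μ C u) (hv : IsBesselFamily μ D v)
    (hp : 1 ≤ p) (hm : AEStronglyMeasurable m μ)
    {ι : Type*} [Fintype ι] {e f : ι → K} (he : Orthonormal ℂ e) (hf : Orthonormal ℂ f) :
    ∑ i, (∫⁻ z, ‖m z‖ₑ * coeffProd u v (e i) (f i) z ∂μ) ^ p ≤
      (∫⁻ z, ‖m z‖ₑ ^ p ∂μ) * (C * D) * (C * D) ^ (p - 1) := by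
  have hmeas := fun i => measurable_coeffProd hu.continuous hv.continuous (e i) (f i)
  have h1 : ∀ {b : ι → K}, Orthonormal ℂ b → ∀ i, ‖b i‖ₑ = 1 := fun hb i => by
    rw [← ofReal_norm, hb.1 i, ENNReal.ofReal_one]
  calc _ ≤ ∑ i, (∫⁻ z, ‖m z‖ₑ ^ p * coeffProd u v (e i) (f i) z ∂μ) * (C * D) ^ (p - 1) := by
        refine Finset.sum_le_sum fun i _ => rpow_lintegral_mul_le hp hm.enorm
          (hmeas i).aemeasurable ?_
        simpa [h1 he, h1 hf] using hu.lintegral_coeffProd_le hv (e i) (f i)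
    _ = (∫⁻ z, ‖m z‖ₑ ^ p * ∑ i, coeffProd u v (e i) (f i) z ∂μ) * (C * D) ^ (p - 1) := by
        simp only [Finset.mul_sum]
        rw [← Finset.sum_mul, lintegral_finsetSum'
          (f := fun i z => ‖m z‖ₑ ^ p * coeffProd u v (e i) (f i) z) _
          fun i _ => (hm.enorm.pow_const p).mul (hmeas i).aemeasurable]
    _ ≤ (∫⁻ z, ‖m z‖ₑ ^ p * (C * D) ∂μ) * (C * D) ^ (p - 1) := by
        gcongr with z
        exact hu.sum_coeffProd_le hv he hf z
    _ = _ := by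
        rw [lintegral_mul_const' _ _ (ENNReal.mul_ne_top ENNReal.coe_ne_top ENNReal.coe_ne_top)]

/-- The integrals that define a localization operator weakly converge absolutely. -/
theorem integrable_form (hu : IsBesselFamily μ C u) (hv : IsBesselFamily μ D v)
    (hp : 1 ≤ p) (hm : MemLp m (ENNReal.ofReal p) μ) (f g : K) :
    Integrable (fun z => m z * inner ℂ (u z) f * (starRingEnd ℂ) (inner ℂ (v z) g)) μ := by
  have hu' := hu.continuous
  have hv' := hv.continuous
  have h1 : Continuous fun z => inner ℂ (u z) f := by fun_prop
  have h2 : Continuous fun z => (starRingEnd ℂ) (inner ℂ (v z) g) := by fun_prop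
  refine ⟨(hm.1.mul h1.aestronglyMeasurable).mul h2.aestronglyMeasurable, ?_⟩
  have hb := hu.lintegral_enorm_mul_coeffProd_le hv hp hm.1 f g
  have he : ∀ z, ‖m z * inner ℂ (u z) f * (starRingEnd ℂ) (inner ℂ (v z) g)‖ₑ =
      ‖m z‖ₑ * coeffProd u v f g z := fun z => by
    simp only [enorm_mul, coeffProd, mul_assoc, RCLike.enorm_conj]
  simp only [HasFiniteIntegral, he]
  refine hb.trans_lt (ENNReal.mul_lt_top hm.2 ?_)
  exact ENNReal.mul_lt_top (ENNReal.mul_lt_top ENNReal.coe_lt_top ENNReal.coe_lt_top)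
    (ENNReal.mul_lt_top enorm_lt_top enorm_lt_top)

theorem enorm_integral_form_le (f g : K) :
    ‖∫ z, m z * inner ℂ (u z) f * (starRingEnd ℂ) (inner ℂ (v z) g) ∂μ‖ₑ ≤
      ∫⁻ z, ‖m z‖ₑ * coeffProd u v f g z ∂μ := by
  refine (enorm_integral_le_lintegral_enorm _).trans_eq ?_
  simp only [enorm_mul, coeffProd, mul_assoc, RCLike.enorm_conj]

theorem norm_integral_form_le (hu : IsBesselFamily μ C u) (hv : IsBesselFamily μ D v)
    (hp : 1 ≤ p) (hm : MemLp m (ENNReal.ofReal p) μ) (f g : K) :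
    ‖∫ z, m z * inner ℂ (u z) f * (starRingEnd ℂ) (inner ℂ (v z) g) ∂μ‖ ≤
      (eLpNorm m (ENNReal.ofReal p) μ).toReal * (C * D) * ‖f‖ * ‖g‖ := by
  have hb := (enorm_integral_form_le f g).trans
    (hu.lintegral_enorm_mul_coeffProd_le hv hp hm.1 f g)
  have := ENNReal.toReal_mono (ENNReal.mul_ne_top hm.2.ne ((ENNReal.mul_ne_top (ENNReal.mul_ne_top
    ENNReal.coe_ne_top ENNReal.coe_ne_top) (ENNReal.mul_ne_top enorm_ne_top enorm_ne_top)))) hb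
  simp only [ENNReal.toReal_mul, toReal_enorm, ENNReal.coe_toReal] at this
  linarith

/-! ### The weakly defined operator and its Schatten class -/

variable [CompleteSpace K]

/-- The bounded operator `∫ m(z) ⟨u z, ·⟩ v z dz`, in the weak sense. -/
theorem exists_operator (hu : IsBesselFamily μ C u) (hv : IsBesselFamily μ D v)
    (hp : 1 ≤ p) (hm : MemLp m (ENNReal.ofReal p) μ) :
    ∃ T : K →L[ℂ] K, ∀ f g : K, inner ℂ g (T f) =
      ∫ z, m z * inner ℂ (u z) f * (starRingEnd ℂ) (inner ℂ (v z) g) ∂μ := by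
  let F : K → K → ℂ := fun f g =>
    ∫ z, m z * inner ℂ (u z) f * (starRingEnd ℂ) (inner ℂ (v z) g) ∂μ
  have hint := hu.integrable_form hv hp hm
  -- The form is conjugated because the representation theorem reads `⟨T f, g⟩ = B f g`, with `B`
  -- conjugate-linear in `f`.
  let B : K →ₗ⋆[ℂ] K →ₗ[ℂ] ℂ := LinearMap.mk₂'ₛₗ (starRingEnd ℂ) (RingHom.id ℂ)
    (fun f g => (starRingEnd ℂ) (F f g))
    (fun f f' g => by
      simp only [F]
      rw [← map_add, ← integral_add (hint f g) (hint f' g)]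
      simp only [inner_add_right, mul_add, add_mul])
    (fun c f g => by
      simp only [F, smul_eq_mul]
      rw [← map_mul, ← integral_const_mul]
      simp only [inner_smul_right]
      congr 2; ext z; ring)
    (fun f g g' => by
      simp only [F]
      rw [← map_add, ← integral_add (hint f g) (hint f g')]
      simp only [inner_add_right, mul_add, map_add])
    (fun c f g => by
      simp only [F, smul_eq_mul, RingHom.id_apply]
      nth_rewrite 2 [← Complex.conj_conj c]
      rw [← map_mul, ← integral_const_mul]
      simp only [inner_smul_right, map_mul]
      congr 2; ext z; ring)
  let B' : K →L⋆[ℂ] K →L[ℂ] ℂ := B.mkContinuous₂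
    ((eLpNorm m (ENNReal.ofReal p) μ).toReal * (C * D)) fun f g => by
      simpa [B, F] using hu.norm_integral_form_le hv hp hm f g
  refine ⟨continuousLinearMapOfBilin B', fun f g => ?_⟩
  rw [← inner_conj_symm, continuousLinearMapOfBilin_apply]
  simp [B', B, F]

theorem norm_le_of_form (hu : IsBesselFamily μ C u) (hv : IsBesselFamily μ D v)
    (hp : 1 ≤ p) (hm : MemLp m (ENNReal.ofReal p) μ) {T : K →L[ℂ] K}
    (hT : ∀ f g : K, inner ℂ g (T f) =
      ∫ z, m z * inner ℂ (u z) f * (starRingEnd ℂ) (inner ℂ (v z) g) ∂μ) :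
    ‖T‖ ≤ (eLpNorm m (ENNReal.ofReal p) μ).toReal * (C * D) := by
  refine T.opNorm_le_bound (by positivity) fun x => ?_
  by_cases h0 : ‖T x‖ = 0
  · rw [h0]; positivity
  have h1 : ‖T x‖ * ‖T x‖ ≤ (eLpNorm m (ENNReal.ofReal p) μ).toReal * (C * D) * ‖x‖ * ‖T x‖ := by
    have h2 := hu.norm_integral_form_le hv hp hm x (T x)
    rw [← hT, inner_self_eq_norm_sq_to_K] at h2
    simpa [pow_two] using h2
  exact le_of_mul_le_mul_right h1 (lt_of_le_of_ne (norm_nonneg _) (Ne.symm h0))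

/-- For such a symbol the weak integral is a Bochner integral, in operator norm, of rank-one
operators. -/
theorem isCompactOperator_of_hasCompactSupport (hu : Continuous u) (hv : Continuous v)
    [IsFiniteMeasureOnCompacts μ]
    (hm : Continuous m) (hms : HasCompactSupport m) {T : K →L[ℂ] K}
    (hT : ∀ f g : K, inner ℂ g (T f) =
      ∫ z, m z * inner ℂ (u z) f * (starRingEnd ℂ) (inner ℂ (v z) g) ∂μ) :
    IsCompactOperator T := by
  let R : X → K →L[ℂ] K := fun z => m z • rankOne ℂ (v z) (u z)
  have hR : Continuous R := by
    have : Continuous fun z => rankOne ℂ (v z) (u z) :=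
      ((ContinuousLinearMap.smulRightL ℂ K K).continuous.comp
        ((innerSL ℂ).continuous.comp hu)).clm_apply hv
    exact hm.smul this
  have hRi : Integrable R μ := hR.integrable_of_hasCompactSupport hms.smul_right
  have hTR : T = ∫ z, R z ∂μ := by
    ext f
    refine ext_inner_left ℂ fun g => ?_
    rw [hT, ContinuousLinearMap.integral_apply hRi, ← integral_inner]
    · congr 1; ext z
      simp [R, inner_smul_right]; ring
    · exact hRi.apply_continuousLinearMap f
  -- The compact operators form a closed, hence complete, subspace; integrating inside it keeps the
  -- value compact.
  let S : Submodule ℂ (K →L[ℂ] K) := compactOperator (RingHom.id ℂ) K K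
  have hS : IsClosed (S : Set (K →L[ℂ] K)) := isClosed_setOfPred_isCompactOperator
  have : CompleteSpace S := hS.completeSpace_coe
  have hmem : ∀ z, R z ∈ S := fun z => by
    refine S.smul_mem _ ?_
    have h1 : IsCompactOperator (innerSL ℂ (u z)) := 
      isCompactOperator_of_locallyCompactSpace_dom (innerSL ℂ (u z))
    exact h1.clm_comp (ContinuousLinearMap.toSpanSingleton ℂ (v z))
  let R' : X → S := fun z => ⟨R z, hmem z⟩
  have hR' : Integrable R' μ := by
    refine (hR.subtype_mk hmem).integrable_of_hasCompactSupport ?_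
    refine hms.mono' fun z hz => subset_closure fun hmz => hz ?_
    exact Subtype.ext (by simp [R, hmz])
  have h2 : ∫ z, R z ∂μ = S.subtypeL (∫ z, R' z ∂μ) :=
    S.subtypeL.integral_comp_comm hR'
  rw [hTR, h2]
  exact (∫ z, R' z ∂μ).2

theorem isCompactOperator_of_form [R1Space X] [WeaklyLocallyCompactSpace X] [NormalSpace X]
    [BorelSpace X] [μ.Regular]
    (hu : IsBesselFamily μ C u) (hv : IsBesselFamily μ D v)
    (hp : 1 ≤ p) (hm : MemLp m (ENNReal.ofReal p) μ) {T : K →L[ℂ] K}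
    (hT : ∀ f g : K, inner ℂ g (T f) =
      ∫ z, m z * inner ℂ (u z) f * (starRingEnd ℂ) (inner ℂ (v z) g) ∂μ) :
    IsCompactOperator T := by
  have hp' : (1 : ℝ≥0∞) ≤ ENNReal.ofReal p := by simpa using hp
  have hclosed : IsClosed {f : K →L[ℂ] K | IsCompactOperator f} :=
    isClosed_setOfPred_isCompactOperator
  suffices h : T ∈ closure {f : K →L[ℂ] K | IsCompactOperator f} by
    rwa [hclosed.closure_eq] at h
  refine Metric.mem_closure_iff.mpr fun ε hε => ?_
  -- The `+ 1` covers `C * D = 0` and makes the final inequality strict.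
  let δ : ℝ := ε / (C * D + 1)
  have hδ : 0 < δ := by positivity
  obtain ⟨n, hns, hmn, hnc, hn⟩ := hm.exists_hasCompactSupport_eLpNorm_sub_le
    ENNReal.ofReal_ne_top (ε := ENNReal.ofReal δ) (by simpa using hδ)
  obtain ⟨N, hN⟩ := hu.exists_operator hv hp hn
  refine ⟨N, isCompactOperator_of_hasCompactSupport hu.continuous hv.continuous hnc hns hN, ?_⟩
  have hTN : ∀ f g : K, inner ℂ g ((T - N) f) =
      ∫ z, (m - n) z * inner ℂ (u z) f * (starRingEnd ℂ) (inner ℂ (v z) g) ∂μ := fun f g => by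
    rw [sub_apply, inner_sub_right, hT, hN,
      ← integral_sub (hu.integrable_form hv hp hm f g) (hu.integrable_form hv hp hn f g)]
    congr 1; ext z
    simp only [Pi.sub_apply]; ring
  have h1 := hu.norm_le_of_form hv hp (hm.sub hn) hTN
  have h2 : (eLpNorm (m - n) (ENNReal.ofReal p) μ).toReal ≤ δ :=
    ENNReal.toReal_le_of_le_ofReal hδ.le hmn
  rw [dist_eq_norm]
  calc ‖T - N‖ ≤ δ * (C * D) := h1.trans (by gcongr)
    _ < δ * (C * D + 1) := by gcongr; linarith
    _ = ε := by simp only [δ]; field_simp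

theorem isSchatten_of_form [R1Space X] [WeaklyLocallyCompactSpace X] [NormalSpace X]
    [BorelSpace X] [μ.Regular]
    (hu : IsBesselFamily μ C u) (hv : IsBesselFamily μ D v)
    (hp : 1 ≤ p) (hm : MemLp m (ENNReal.ofReal p) μ) {T : K →L[ℂ] K}
    (hT : ∀ f g : K, inner ℂ g (T f) =
      ∫ z, m z * inner ℂ (u z) f * (starRingEnd ℂ) (inner ℂ (v z) g) ∂μ) :
    IsSchatten p T := by
  have hp0 : 0 < p := by linarith
  refine ⟨isCompactOperator_of_form hu hv hp hm hT, ?_⟩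
  have hfin : ∫⁻ z, ‖m z‖ₑ ^ p ∂μ ≠ ∞ := by
    have := (lintegral_rpow_enorm_lt_top_of_eLpNorm_lt_top (by simpa using hp0)
      ENNReal.ofReal_ne_top hm.2).ne
    rwa [ENNReal.toReal_ofReal hp0.le] at this
  set A : ℝ≥0∞ := (∫⁻ z, ‖m z‖ₑ ^ p ∂μ) * (C * D) * (C * D) ^ (p - 1) with hA
  have hAtop : A ≠ ∞ := by
    refine ENNReal.mul_ne_top (ENNReal.mul_ne_top hfin ?_)
      (ENNReal.rpow_ne_top_of_nonneg (by linarith) ?_) <;>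
    exact ENNReal.mul_ne_top ENNReal.coe_ne_top ENNReal.coe_ne_top
  refine summable_singularMultiplicity T p A.toReal fun ι _ e f he hf => ?_
  have hb := hu.sum_rpow_lintegral_le hv hp hm.1 he hf
  have hle : ∑ i, ‖inner ℂ (f i) (T (e i))‖ₑ ^ p ≤ A := by
    refine le_trans (Finset.sum_le_sum fun i _ => ?_) hb
    rw [hT]
    gcongr
    exact enorm_integral_form_le (e i) (f i)
  have := ENNReal.toReal_mono hAtop hle
  rw [ENNReal.toReal_sum fun i _ => ENNReal.rpow_ne_top_of_nonneg hp0.le enorm_ne_top] at this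
  simpa [← ENNReal.toReal_rpow] using this

end IsBesselFamily

end Bessel

open FourierTransform

/-! ### Plancherel for the Fourier integral -/

section Plancherel

theorem enorm_sq_eq_lintegral {X : Type*} [MeasurableSpace X] {μ : Measure X} (f : Lp ℂ 2 μ) :
    ‖f‖ₑ ^ 2 = ∫⁻ t, ‖f t‖ₑ ^ 2 ∂μ := by
  rw [Lp.enorm_def, eLpNorm_eq_lintegral_rpow_enorm_toReal two_ne_zero ENNReal.ofNat_ne_top,
    ← ENNReal.rpow_natCast, ← ENNReal.rpow_mul]
  simp

variable {E : Type*} [NormedAddCommGroup E] [InnerProductSpace ℝ E] [FiniteDimensional ℝ E]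
  [MeasurableSpace E] [BorelSpace E]

/-- The `L²` Fourier transform is given by the Fourier integral on `L¹ ∩ L²`. -/
theorem fourier_toLp_ae_eq {h : E → ℂ} (h1 : Integrable h) (h2 : MemLp h 2) :
    (𝓕 (h2.toLp h) : Lp ℂ 2 (volume : Measure E)) =ᵐ[volume] 𝓕 h := by
  -- Both transforms are locally integrable, so it suffices to compare them against test functions,
  -- where each moves the Fourier transform onto the test function.
  have hcont : Continuous (𝓕 h) :=
    VectorFourier.fourierIntegral_continuous Real.continuous_fourierChar continuous_inner h1
  refine ae_eq_of_integral_contDiff_smul_eq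
    ((Lp.memLp _).locallyIntegrable (by norm_num)) hcont.locallyIntegrable fun g hg hgs => ?_
  have hg₁ : HasCompactSupport (Complex.ofRealCLM ∘ g) := hgs.comp_left rfl
  have hg₂ : ContDiff ℝ (⊤ : ℕ∞) (Complex.ofRealCLM ∘ g) := by fun_prop
  let φ : SchwartzMap E ℂ := hg₁.toSchwartzMap hg₂
  have e1 := congrArg (fun T => T φ) (Lp.fourier_toTemperedDistribution_eq (h2.toLp h))
  simp only [TemperedDistribution.fourier_apply, Lp.toTemperedDistribution_apply] at e1
  have e2 : ∫ x, (𝓕 φ) x • (h2.toLp h) x = ∫ x, (𝓕 φ) x • h x :=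
    integral_congr_ae (h2.coeFn_toLp.mono fun x hx => by simp only [hx])
  have e3 : ∫ x, (𝓕 (φ : E → ℂ)) x • h x = ∫ x, φ x • (𝓕 h) x := by
    have := VectorFourier.integral_fourierIntegral_smul_eq_flip (L := innerₗ E)
      (μ := volume) (ν := volume) Real.continuous_fourierChar continuous_inner φ.integrable h1
    simpa using! this
  rw [e2, SchwartzMap.fourier_coe, e3] at e1
  simpa [φ] using! e1.symm

/-- Plancherel's theorem for the Fourier integral on `L¹ ∩ L²`. -/
theorem lintegral_enorm_fourier_sq {h : E → ℂ} (h1 : Integrable h) (h2 : MemLp h 2) :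
    ∫⁻ w, ‖𝓕 h w‖ₑ ^ 2 = ∫⁻ t, ‖h t‖ₑ ^ 2 := by
  have e : ‖(𝓕 (h2.toLp h) : Lp ℂ 2 (volume : Measure E))‖ₑ = ‖h2.toLp h‖ₑ := by
    rw [← ofReal_norm, ← ofReal_norm, Lp.norm_fourier_eq]
  calc ∫⁻ w, ‖𝓕 h w‖ₑ ^ 2
      = ∫⁻ w, ‖(𝓕 (h2.toLp h) : Lp ℂ 2 (volume : Measure E)) w‖ₑ ^ 2 :=
        lintegral_congr_ae ((fourier_toLp_ae_eq h1 h2).mono fun w hw => by simp only [hw])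
    _ = ∫⁻ t, ‖(h2.toLp h) t‖ₑ ^ 2 := by
        rw [← enorm_sq_eq_lintegral, e, enorm_sq_eq_lintegral]
    _ = _ := lintegral_congr_ae (h2.coeFn_toLp.mono fun x hx => by simp only [hx])

end Plancherel

/-! ### Time-frequency shifts and Moyal's identity -/

section Shift

variable {d : ℕ}

theorem coeFn_shift (z : TFPlane d) (g : L2 d) :
    shift z g =ᵐ[volume] fun t => Real.fourierChar (inner ℝ z.2 t) • g (t - z.1) :=
  (memLp_shift z g).coeFn_toLp

theorem shift_sub (z : TFPlane d) (g h : L2 d) : shift z (g - h) = shift z g - shift z h := by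
  rw [shift, shift, shift, ← MemLp.toLp_sub]
  refine MemLp.toLp_congr _ _ ?_
  filter_upwards [(measurePreserving_sub_right volume z.1).quasiMeasurePreserving.ae_eq_comp
    (Lp.coeFn_sub g h)] with t ht
  simp only [Function.comp_apply, Pi.sub_apply] at ht
  simp only [Pi.sub_apply, ht, smul_sub]

theorem norm_shift (z : TFPlane d) (g : L2 d) : ‖shift z g‖ = ‖g‖ := by
  have hτ := measurePreserving_sub_right (volume : Measure (EuclideanSpace ℝ (Fin d))) z.1
  rw [shift, Lp.norm_toLp, ← Lp.norm_compMeasurePreserving g hτ, Lp.norm_def]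
  congr 1
  refine eLpNorm_congr_norm_ae ?_
  filter_upwards [Lp.coeFn_compMeasurePreserving g hτ] with t ht
  rw [Circle.norm_smul, ht, Function.comp_apply]

/-- Dominated convergence with majorant `(2|g|)²`. -/
theorem continuous_shift_zero_left (g : L2 d) :
    Continuous fun w : EuclideanSpace ℝ (Fin d) => shift (0, w) g := by
  refine continuous_iff_continuousAt.mpr fun w₀ => ?_
  unfold shift ContinuousAt
  rw [Lp.tendsto_Lp_iff_tendsto_eLpNorm'']
  simp only [eLpNorm_eq_lintegral_rpow_enorm_toReal two_ne_zero ENNReal.ofNat_ne_top]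
  rw [show (0 : ℝ≥0∞) = 0 ^ (1 / (2 : ℝ≥0∞).toReal) by simp]
  refine (ENNReal.continuous_rpow_const.tendsto 0).comp ?_
  rw [show (0 : ℝ≥0∞) = ∫⁻ _ : EuclideanSpace ℝ (Fin d), 0 by simp]
  have hg := (Lp.stronglyMeasurable g).measurable
  have hmeas : ∀ w : EuclideanSpace ℝ (Fin d), Measurable
      fun t => (Real.fourierChar (inner ℝ w t) : ℂ) * g (t - 0) := fun w => by
    have : Continuous fun t : EuclideanSpace ℝ (Fin d) =>
      (Real.fourierChar (inner ℝ w t) : ℂ) := by fun_prop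
    exact this.measurable.mul (hg.comp (measurable_id.sub_const 0))
  refine tendsto_lintegral_filter_of_dominated_convergence (fun t => (2 * ‖g t‖ₑ) ^ (2 : ℝ))
    (Eventually.of_forall fun w => ?_) (Eventually.of_forall fun w => ae_of_all _ fun t => ?_)
    ?_ (ae_of_all _ fun t => ?_)
  · exact (((hmeas w).sub (hmeas w₀)).enorm.pow_const _)
  · simp only [Pi.sub_apply, ENNReal.toReal_ofNat]
    gcongr
    refine (enorm_sub_le).trans_eq ?_
    simp only [sub_zero, ← ofReal_norm, Circle.norm_smul, two_mul]
  · simp only [ENNReal.mul_rpow_of_nonneg _ _ zero_le_two, ENNReal.rpow_two]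
    rw [lintegral_const_mul' _ _ (by simp), ← enorm_sq_eq_lintegral]
    exact ENNReal.mul_ne_top (by simp) (by simp)
  · have hc : Continuous fun w : EuclideanSpace ℝ (Fin d) =>
        ‖(Real.fourierChar (inner ℝ w t) : ℂ) * g (t - 0) -
          (Real.fourierChar (inner ℝ w₀ t) : ℂ) * g (t - 0)‖ₑ ^ (2 : ℝ) :=
      ENNReal.continuous_rpow_const.comp (Continuous.enorm (by fun_prop))
    simpa using! hc.tendsto w₀

/-- Factor the shift as modulation after translation. Translation is continuous in `L²`; modulation
is jointly continuous, being continuous in frequency and 1-Lipschitz in the function. -/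
theorem continuous_shift (g : L2 d) : Continuous fun z : TFPlane d => shift z g := by
  let τ : EuclideanSpace ℝ (Fin d) → L2 d := fun x =>
    Lp.compMeasurePreserving (fun t => t - x) (measurePreserving_sub_right volume x) g
  have hτ : Continuous τ := by
    let c : C(EuclideanSpace ℝ (Fin d), C(EuclideanSpace ℝ (Fin d), EuclideanSpace ℝ (Fin d))) :=
      (ContinuousMap.mk (fun a : EuclideanSpace ℝ (Fin d) × EuclideanSpace ℝ (Fin d) => a.2 - a.1)
        (by fun_prop)).curry
    exact continuous_const.compMeasurePreservingLp c.continuous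
      (fun x => measurePreserving_sub_right volume x) ENNReal.ofNat_ne_top
  have hmod : Continuous fun q : L2 d × EuclideanSpace ℝ (Fin d) => shift (0, q.2) q.1 :=
    continuous_prod_of_continuous_lipschitzWith _ 1 continuous_shift_zero_left fun w =>
      LipschitzWith.of_dist_le_mul fun g h => by
        simp [dist_eq_norm, ← shift_sub, norm_shift]
  have heq : ∀ z : TFPlane d, shift (0, z.2) (τ z.1) = shift z g := fun z => by
    refine MemLp.toLp_congr _ _ ?_
    filter_upwards [Lp.coeFn_compMeasurePreserving g (measurePreserving_sub_right volume z.1)]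
      with t ht
    rw [sub_zero, ht, Function.comp_apply]
  have hpair : Continuous fun z : TFPlane d => (τ z.1, z.2) :=
    (hτ.comp continuous_fst).prodMk continuous_snd
  exact (hmod.comp hpair).congr heq

/-- The conjugated modulation is the Fourier kernel, so Plancherel applies in `ω` for fixed `x`. -/
theorem inner_shift_eq_fourier (z : TFPlane d) (a f : L2 d) :
    inner ℂ (shift z a) f = 𝓕 (fun t => (starRingEnd ℂ) (a (t - z.1)) * f t) z.2 := by
  rw [L2.inner_def, Real.fourier_eq]
  refine integral_congr_ae ((coeFn_shift z a).mono fun t ht => ?_)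
  simp only [ht, RCLike.inner_apply, Circle.smul_def, smul_eq_mul, map_mul,
    real_inner_comm z.2 t, AddChar.map_neg_eq_inv, Circle.coe_inv_eq_conj]
  ring

/-- Moyal's identity: the short-time Fourier transform is a multiple of an isometry. -/
theorem lintegral_enorm_inner_shift_sq (a f : L2 d) :
    ∫⁻ z : TFPlane d, ‖inner ℂ (shift z a) f‖ₑ ^ 2 = (‖a‖ₑ * ‖f‖ₑ) ^ 2 := by
  let h : EuclideanSpace ℝ (Fin d) → EuclideanSpace ℝ (Fin d) → ℂ :=
    fun x t => (starRingEnd ℂ) (a (t - x)) * f t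
  have ha := (Lp.stronglyMeasurable a).measurable
  have hf := (Lp.stronglyMeasurable f).measurable
  have hh : Measurable (Function.uncurry h) := by
    have : Measurable fun q : EuclideanSpace ℝ (Fin d) × EuclideanSpace ℝ (Fin d) =>
      a (q.2 - q.1) := ha.comp (measurable_snd.sub measurable_fst)
    exact (Complex.continuous_conj.measurable.comp this).mul (hf.comp measurable_snd)
  have hax : ∀ x, MemLp (fun t => (starRingEnd ℂ) (a (t - x))) 2 volume := fun x =>
    ((Lp.memLp a).comp_measurePreserving (measurePreserving_sub_right volume x)).star
  have hint : ∀ x, Integrable (h x) := fun x => (hax x).integrable_mul (Lp.memLp f)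
  have htot : ∫⁻ x, ∫⁻ t, ‖h x t‖ₑ ^ 2 = (‖a‖ₑ * ‖f‖ₑ) ^ 2 := by
    rw [lintegral_lintegral_swap (hh.enorm.pow_const 2).aemeasurable]
    have : ∀ t, ∫⁻ x, ‖h x t‖ₑ ^ 2 = ‖a‖ₑ ^ 2 * ‖f t‖ₑ ^ 2 := fun t => by
      simp only [h, enorm_mul, RCLike.enorm_conj, mul_pow]
      rw [lintegral_mul_const' _ _ (by simp), enorm_sq_eq_lintegral,
        lintegral_sub_left_eq_self (fun y => ‖a y‖ₑ ^ 2) t]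
    simp only [this]
    rw [lintegral_const_mul' _ _ (by simp), ← enorm_sq_eq_lintegral, mul_pow]
  -- Each `h x` is in `L¹`, but square integrability is obtained only for almost every `x`, by
  -- Tonelli.
  have hfin : ∀ᵐ x, ∫⁻ t, ‖h x t‖ₑ ^ 2 < ∞ := by
    refine ae_lt_top (hh.enorm.pow_const 2).lintegral_prod_right' ?_
    rw [htot]
    exact ENNReal.pow_ne_top (ENNReal.mul_ne_top enorm_ne_top enorm_ne_top)
  have hcont : Continuous fun z : TFPlane d => inner ℂ (shift z a) f :=
    (continuous_shift a).inner continuous_const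
  rw [← htot, Measure.volume_eq_prod,
    lintegral_prod _ (hcont.enorm.measurable.pow_const 2).aemeasurable]
  refine lintegral_congr_ae (hfin.mono fun x hx => ?_)
  simp only [inner_shift_eq_fourier]
  refine lintegral_enorm_fourier_sq (hint x) ⟨(hint x).1, ?_⟩
  rw [eLpNorm_lt_top_iff_lintegral_rpow_enorm_lt_top two_ne_zero ENNReal.ofNat_ne_top]
  simpa only [ENNReal.toReal_ofNat, ENNReal.rpow_two] using hx

theorem memLp_inner_shift (a f : L2 d) :
    MemLp (fun z : TFPlane d => inner ℂ (shift z a) f) 2 volume := by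
  have hcont : Continuous fun z : TFPlane d => inner ℂ (shift z a) f :=
    (continuous_shift a).inner continuous_const
  refine ⟨hcont.aestronglyMeasurable, ?_⟩
  rw [eLpNorm_lt_top_iff_lintegral_rpow_enorm_lt_top two_ne_zero ENNReal.ofNat_ne_top]
  simp only [ENNReal.toReal_ofNat, ENNReal.rpow_two, lintegral_enorm_inner_shift_sq]
  exact ENNReal.pow_lt_top (ENNReal.mul_lt_top enorm_lt_top enorm_lt_top)

/-- The orthogonality relation for the short-time Fourier transform. -/
theorem integral_conj_inner_shift_mul (a f f' : L2 d) :
    ∫ z : TFPlane d, (starRingEnd ℂ) (inner ℂ (shift z a) f) * inner ℂ (shift z a) f' =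
      (‖a‖ : ℂ) ^ 2 * inner ℂ f f' := by
  let W : L2 d →ₗ[ℂ] Lp ℂ 2 (volume : Measure (TFPlane d)) :=
    { toFun := fun f => (memLp_inner_shift a f).toLp _
      map_add' := fun f g => by
        rw [← MemLp.toLp_add]
        exact MemLp.toLp_congr _ _ (ae_of_all _ fun z => by simp [inner_add_right])
      map_smul' := fun c f => by
        rw [RingHom.id_apply, ← MemLp.toLp_const_smul]
        exact MemLp.toLp_congr _ _ (ae_of_all _ fun z => by simp [inner_smul_right]) }
  have hWf : ∀ f, W f =ᵐ[volume] fun z => inner ℂ (shift z a) f := fun f =>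
    (memLp_inner_shift a f).coeFn_toLp
  have hW : ∀ f, ‖W f‖ = ‖a‖ * ‖f‖ := fun f => by
    have h1 : ‖W f‖ₑ ^ 2 = (‖a‖ₑ * ‖f‖ₑ) ^ 2 := by
      rw [enorm_sq_eq_lintegral, ← lintegral_enorm_inner_shift_sq]
      exact lintegral_congr_ae ((hWf f).mono fun z hz => by simp only [hz])
    have h2 := congrArg ENNReal.toReal h1
    simp only [ENNReal.toReal_pow, ENNReal.toReal_mul, toReal_enorm] at h2
    exact (pow_left_inj₀ (norm_nonneg _) (by positivity) two_ne_zero).mp h2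
  have hin : inner ℂ (W f) (W f') = (‖a‖ : ℂ) ^ 2 * inner ℂ f f' := by
    -- Polarization of the norm identity `hW`.
    rw [inner_eq_sum_norm_sq_div_four (𝕜 := ℂ) (W f), inner_eq_sum_norm_sq_div_four (𝕜 := ℂ) f]
    simp only [← map_add, ← map_sub, ← map_smul, hW]
    change _ = (RCLike.ofReal ‖a‖ : ℂ) ^ 2 * _
    simp only [RCLike.ofReal_mul]
    ring
  rw [← hin, L2.inner_def]
  refine integral_congr_ae ?_
  filter_upwards [hWf f, hWf f'] with z h1 h2
  simp only [h1, h2, RCLike.inner_apply, mul_comm]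

end Shift

/-! ### Passage to the Hilbert space tensor product -/

section Tensor

variable {d : ℕ}

theorem inner_simpleTensor (a b a' b' : L2 d) :
    inner ℂ (simpleTensor a b) (simpleTensor a' b') = inner ℂ a a' * inner ℂ b b' := by
  simp [simpleTensor, UniformSpace.Completion.inner_coe]

theorem continuous_simpleTensor_shift (a b : L2 d) :
    Continuous fun z : TFPlane d × TFPlane d => simpleTensor (shift z.1 a) (shift z.2 b) :=
  (UniformSpace.Completion.continuous_coe _).comp (TensorProduct.continuous_tmul.comp
    (((continuous_shift a).comp continuous_fst).prodMk ((continuous_shift b).comp continuous_snd)))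

/-- On simple tensors the integral factors by Fubini. The sesquilinear form is what extends
additively in each argument, and integrability travels with it so that integrals of sums split. -/
theorem integral_conj_stft_mul (a b : L2 d) (x y : L2 d ⊗[ℂ] L2 d) :
    Integrable (fun z => (starRingEnd ℂ) (stft a b x z) * stft a b y z) ∧
    ∫ z, (starRingEnd ℂ) (stft a b x z) * stft a b y z =
      (‖a‖ : ℂ) ^ 2 * (‖b‖ : ℂ) ^ 2 * inner ℂ x y := by
  induction x using TensorProduct.induction_on with
  | zero => simp [stft, UniformSpace.Completion.coe_zero]
  | add x₁ x₂ h₁ h₂ =>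
    have e : ∀ z, (starRingEnd ℂ) (stft a b ((x₁ + x₂ : L2 d ⊗[ℂ] L2 d) : L2Tensor d) z) *
        stft a b y z = (starRingEnd ℂ) (stft a b x₁ z) * stft a b y z +
          (starRingEnd ℂ) (stft a b x₂ z) * stft a b y z := fun z => by
      simp only [stft, UniformSpace.Completion.coe_add, inner_add_right, map_add, add_mul]
    simp only [e]
    exact ⟨h₁.1.add h₂.1, by rw [integral_add h₁.1 h₂.1, h₁.2, h₂.2, inner_add_left, mul_add]⟩
  | tmul f g =>
    induction y using TensorProduct.induction_on with
    | zero => simp [stft, UniformSpace.Completion.coe_zero]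
    | add y₁ y₂ h₁ h₂ =>
      have e : ∀ z, (starRingEnd ℂ) (stft a b ((f ⊗ₜ[ℂ] g : L2 d ⊗[ℂ] L2 d) : L2Tensor d) z) *
          stft a b ((y₁ + y₂ : L2 d ⊗[ℂ] L2 d) : L2Tensor d) z =
          (starRingEnd ℂ) (stft a b ((f ⊗ₜ[ℂ] g : L2 d ⊗[ℂ] L2 d) : L2Tensor d) z) *
            stft a b y₁ z +
          (starRingEnd ℂ) (stft a b ((f ⊗ₜ[ℂ] g : L2 d ⊗[ℂ] L2 d) : L2Tensor d) z) *
            stft a b y₂ z := fun z => by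
        simp only [stft, UniformSpace.Completion.coe_add, inner_add_right, mul_add]
      simp only [e]
      exact ⟨h₁.1.add h₂.1, by rw [integral_add h₁.1 h₂.1, h₁.2, h₂.2, inner_add_right, mul_add]⟩
    | tmul f' g' =>
      have e : ∀ z, (starRingEnd ℂ) (stft a b ((f ⊗ₜ[ℂ] g : L2 d ⊗[ℂ] L2 d) : L2Tensor d) z) *
          stft a b ((f' ⊗ₜ[ℂ] g' : L2 d ⊗[ℂ] L2 d) : L2Tensor d) z =
          ((starRingEnd ℂ) (inner ℂ (shift z.1 a) f) * inner ℂ (shift z.1 a) f') *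
          ((starRingEnd ℂ) (inner ℂ (shift z.2 b) g) * inner ℂ (shift z.2 b) g') := fun z => by
        have := fun f g => inner_simpleTensor (shift z.1 a) (shift z.2 b) f g
        simp only [simpleTensor] at this
        simp only [stft, simpleTensor, this, map_mul]
        ring
      have hi : ∀ a f f' : L2 d, Integrable fun z : TFPlane d =>
          (starRingEnd ℂ) (inner ℂ (shift z a) f) * inner ℂ (shift z a) f' := fun a f f' =>
        (memLp_inner_shift a f).star.integrable_mul (memLp_inner_shift a f')
      simp only [e]
      refine ⟨(hi a f f').mul_prod (hi b g g'), ?_⟩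
      rw [Measure.volume_eq_prod, integral_prod_mul
        (fun z => (starRingEnd ℂ) (inner ℂ (shift z a) f) * inner ℂ (shift z a) f')
        (fun z => (starRingEnd ℂ) (inner ℂ (shift z b) g) * inner ℂ (shift z b) g'),
        integral_conj_inner_shift_mul, integral_conj_inner_shift_mul, TensorProduct.inner_tmul]
      ring

theorem lintegral_enorm_stft_coe_sq (a b : L2 d) (x : L2 d ⊗[ℂ] L2 d) :
    ∫⁻ z, ‖stft a b x z‖ₑ ^ 2 = (‖a‖ₑ * ‖b‖ₑ * ‖x‖ₑ) ^ 2 := by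
  obtain ⟨h1, h2⟩ := integral_conj_stft_mul a b x x
  have e : ∀ z, (starRingEnd ℂ) (stft a b x z) * stft a b x z =
      ((‖stft a b x z‖ ^ 2 : ℝ) : ℂ) := fun z => by
    rw [Complex.conj_mul']; push_cast; rfl
  simp only [e] at h1 h2
  have hxx := inner_self_eq_norm_sq_to_K (𝕜 := ℂ) x
  rw [integral_complex_ofReal, hxx] at h2
  have h3 : ∫ z, ‖stft a b x z‖ ^ 2 = (‖a‖ * ‖b‖ * ‖x‖) ^ 2 := by
    have : ((∫ z, ‖stft a b x z‖ ^ 2 : ℝ) : ℂ) = (((‖a‖ * ‖b‖ * ‖x‖) ^ 2 : ℝ) : ℂ) := by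
      refine h2.trans ?_
      change _ * (Complex.ofReal ‖x‖) ^ 2 = _
      push_cast; ring
    exact_mod_cast this
  have h4 : Integrable fun z => ‖stft a b x z‖ ^ 2 := by
    simpa only [RCLike.re_to_complex, Complex.ofReal_re] using h1.re
  have h5 := ofReal_integral_eq_lintegral_ofReal h4 (ae_of_all _ fun z => by positivity)
  rw [h3] at h5
  simp only [← ofReal_norm]
  rw [← ENNReal.ofReal_mul (by positivity), ← ENNReal.ofReal_mul (by positivity),
    ← ENNReal.ofReal_pow (by positivity), h5]
  simp only [ENNReal.ofReal_pow (norm_nonneg _)]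

/-- The norm bound is multiplicativity of the tensor norm. The `L²` bound is an equality on
algebraic tensors; Fatou's lemma carries it to the completion as an inequality. -/
theorem isBesselFamily_simpleTensor_shift (a b : L2 d) :
    IsBesselFamily volume (‖a‖₊ * ‖b‖₊)
      fun z : TFPlane d × TFPlane d => simpleTensor (shift z.1 a) (shift z.2 b) where
  continuous := continuous_simpleTensor_shift a b
  enorm_le z := by
    simp only [simpleTensor, UniformSpace.Completion.enorm_coe, TensorProduct.enorm_tmul]
    simp only [← ofReal_norm, norm_shift]
    simp [enorm_eq_nnnorm]
  lintegral_le f := by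
    change ∫⁻ z, ‖stft a b f z‖ₑ ^ 2 ≤ _
    push_cast
    obtain ⟨x, hx, hxf⟩ := mem_closure_iff_seq_limit.mp
      (UniformSpace.Completion.denseRange_coe (α := L2 d ⊗[ℂ] L2 d) f)
    choose y hy using hx
    have hcont : ∀ f : L2Tensor d, Continuous (stft a b f) := fun f =>
      (continuous_simpleTensor_shift a b).inner continuous_const
    have hlim : ∀ z, Tendsto (fun n => ‖stft a b (x n) z‖ₑ ^ 2) atTop
        (𝓝 (‖stft a b f z‖ₑ ^ 2)) := fun z => by
      refine ENNReal.Tendsto.pow (Tendsto.enorm ?_)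
      exact tendsto_const_nhds.inner hxf
    have hlim2 : Tendsto (fun n => (‖a‖ₑ * ‖b‖ₑ * ‖x n‖ₑ) ^ 2) atTop
        (𝓝 ((‖a‖ₑ * ‖b‖ₑ * ‖f‖ₑ) ^ 2)) :=
      ENNReal.Tendsto.pow (ENNReal.Tendsto.const_mul hxf.enorm
        (Or.inr (ENNReal.mul_ne_top enorm_ne_top enorm_ne_top)))
    calc ∫⁻ z, ‖stft a b f z‖ₑ ^ 2
        = ∫⁻ z, liminf (fun n => ‖stft a b (x n) z‖ₑ ^ 2) atTop := by
          simp only [(hlim _).liminf_eq]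
      _ ≤ liminf (fun n => ∫⁻ z, ‖stft a b (x n) z‖ₑ ^ 2) atTop :=
          lintegral_liminf_le fun n => (hcont _).enorm.measurable.pow_const 2
      _ = liminf (fun n => (‖a‖ₑ * ‖b‖ₑ * ‖x n‖ₑ) ^ 2) atTop := by
          simp only [← hy, lintegral_enorm_stft_coe_sq, UniformSpace.Completion.enorm_coe]
      _ = _ := hlim2.liminf_eq

/-- Regularity supplies the density of continuous compactly supported symbols in `L^p`. -/
theorem regular_volume_tfPlane_prod :
    (volume : Measure (TFPlane d × TFPlane d)).Regular := by
  have : (volume : Measure (TFPlane d)).IsAddHaarMeasure :=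
    Measure.prod.instIsAddHaarMeasure volume volume
  have : (volume : Measure (TFPlane d × TFPlane d)).IsAddHaarMeasure :=
    Measure.prod.instIsAddHaarMeasure volume volume
  have : BorelSpace (TFPlane d × TFPlane d) := Prod.borelSpace
  have : IsLocallyFiniteMeasure (volume : Measure (TFPlane d × TFPlane d)) := inferInstance
  exact Measure.Regular.of_sigmaCompactSpace_of_isLocallyFiniteMeasure _

theorem eq_zero_of_inner_simpleTensor {x : L2Tensor d}
    (h : ∀ a b : L2 d, inner ℂ (simpleTensor a b) x = 0) : x = 0 := by
  have h1 : ∀ y : L2 d ⊗[ℂ] L2 d, inner ℂ (y : L2Tensor d) x = 0 := fun y => by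
    induction y using TensorProduct.induction_on with
    | zero => simp [UniformSpace.Completion.coe_zero]
    | add y₁ y₂ h₁ h₂ => rw [UniformSpace.Completion.coe_add, inner_add_left, h₁, h₂, add_zero]
    | tmul a b => exact h a b
  refine (inner_self_eq_zero (𝕜 := ℂ)).mp ?_
  have h2 : ∀ y : L2Tensor d, inner ℂ y x = 0 := fun y =>
    UniformSpace.Completion.induction_on y
      (isClosed_eq (by fun_prop) continuous_const) h1
  exact h2 x

theorem continuousLinearMap_ext_simpleTensor {S T : L2Tensor d →L[ℂ] L2Tensor d}
    (h : ∀ a b : L2 d, S (simpleTensor a b) = T (simpleTensor a b)) : S = T := by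
  ext x
  refine UniformSpace.Completion.induction_on x
    (isClosed_eq (by fun_prop) (by fun_prop)) fun y => ?_
  induction y using TensorProduct.induction_on with
  | zero => simp [UniformSpace.Completion.coe_zero]
  | add y₁ y₂ h₁ h₂ => simp only [UniformSpace.Completion.coe_add, map_add, h₁, h₂]
  | tmul a b => exact h a b

end Tensor

end BilinearSTFT

theorem proposition6p4 (d : ℕ) (φ₁ φ₂ ψ₁ ψ₂ : BilinearSTFT.L2 d)
    (hφ₁ : φ₁ ≠ 0) (hφ₂ : φ₂ ≠ 0) (hψ₁ : ψ₁ ≠ 0) (hψ₂ : ψ₂ ≠ 0)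
    (p : ℝ) (hp : 1 ≤ p) (m : BilinearSTFT.TFPlane d × BilinearSTFT.TFPlane d → ℂ)
    (hm : MemLp m (ENNReal.ofReal p) volume) :
    -- the integrals that define the operator converge absolutely
    (∀ f g : BilinearSTFT.L2Tensor d,
      Integrable (BilinearSTFT.locIntegrand m φ₁ φ₂ ψ₁ ψ₂ f g) volume) ∧
    ∃ M : BilinearSTFT.L2Tensor d →L[ℂ] BilinearSTFT.L2Tensor d,
      -- `M` is the operator that is weakly given by these integrals
      (∀ f g : BilinearSTFT.L2Tensor d,
        inner ℂ g (M f) = ∫ z, BilinearSTFT.locIntegrand m φ₁ φ₂ ψ₁ ψ₂ f g z) ∧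
      -- it is the only bounded operator for which the identity holds on simple tensors
      (∀ M' : BilinearSTFT.L2Tensor d →L[ℂ] BilinearSTFT.L2Tensor d,
        (∀ f₁ f₂ g₁ g₂ : BilinearSTFT.L2 d,
          inner ℂ (BilinearSTFT.simpleTensor g₁ g₂) (M' (BilinearSTFT.simpleTensor f₁ f₂)) =
            ∫ z, BilinearSTFT.locIntegrand m φ₁ φ₂ ψ₁ ψ₂
              (BilinearSTFT.simpleTensor f₁ f₂) (BilinearSTFT.simpleTensor g₁ g₂) z) →
        M' = M) ∧
      BilinearSTFT.IsSchatten p M := by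
  have := BilinearSTFT.regular_volume_tfPlane_prod (d := d)
  have hu := BilinearSTFT.isBesselFamily_simpleTensor_shift φ₁ φ₂
  have hv := BilinearSTFT.isBesselFamily_simpleTensor_shift ψ₁ ψ₂
  refine ⟨hu.integrable_form hv hp hm, ?_⟩
  obtain ⟨M, hM⟩ := hu.exists_operator hv hp hm
  refine ⟨M, hM, fun M' hM' => ?_, hu.isSchatten_of_form hv hp hm hM⟩
  refine BilinearSTFT.continuousLinearMap_ext_simpleTensor fun f₁ f₂ => sub_eq_zero.mp ?_
  refine BilinearSTFT.eq_zero_of_inner_simpleTensor fun g₁ g₂ => ?_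
  rw [inner_sub_right, hM', hM]
  exact sub_self _
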